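/- A DMDP is a finite Markov Decision Problem $M=(S,A,T,R,\gamma)$ with $|S|=n\ge 2$ states, $|A|=k\ge 2$ actions (all available in every state), rewards $R:S\times A\to\mathbb R$, discount factor $\gamma\in[0,1)$, and transition probabilities $T(s,a,s')\in\{0,1\}$ with $\sum_{s'}T(s,a,s')=1$. For a policy $\pi:S\to A$, let $V^\pi(s)=\mathbb E\big[\sum_{t\ge 0}\gamma^tR(s_t,\pi(s_t))\big]$ be its value function (where $s_0=s$ and $s_{t+1}\sim T(s_t,\pi(s_t),\cdot)$), let $Q^\pi(s,a)=R(s,a)+\gamma\sum_{s'}T(s,a,s')V^\pi(s')$, let $\rho^\pi(s,a)=Q^\pi(s,a)-V^\pi(s)$ be the gain, and let $I^\pi=\{(s,a):\rho^\pi(s,a)>0\}$. A policy is optimal if its value is at every state at least that of every other policy. A step of policy improvement with max-gain action selection chooses a non-empty set $I\subseteq I^\pi$ that contains at most one pair $(s,a)$ for each state $s$, such that each $(s,a)\in I$ maximises $\rho^\pi(s,a')$ over all $a'$ with $(s,a')\in I^\pi$, and replaces $\pi$ by the policy $\pi'$ with $\pi'(s)=a$ if $(s,a)\in I$ and $\pi'(s)=\pi(s)$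 at all other states. A run of a policy iteration (PI) algorithm with max-gain action selection starts at an arbitrary policy, performs such steps, chosen in any way, as long as $I^\pi\ne\emptyset$, and stops when $I^\pi=\emptyset$. **Corollary.** Every run of a PI algorithm with max-gain action selection on an $n$-state, $k$-action DMDP ($n,k\ge 2$) terminates, at an optimal policy, within $$B(n,k)=(n+1)\,n^2\,k\,\big((k+1)!\big)^{(n-1)/(k+1)}$$ steps; indeed, it visits at most $B(n,k)$ policies, the initial and the final one included. Moreover $$B(n,k)=O\!\left(n^3\left(\Big(1+O\Big(\frac{\log k}{k}\Big)\Big)\frac ke\right)^n\right)$$ uniformly in $n,k\ge 2$: there are absolute constants $C,c>0$ such that, for all integers $n,k\ge 2$, $$B(n,k)\le C\,n^3\left(\Big(1+c\,\frac{\log k}{k}\Big)\frac ke\right)^n .$$ -/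

import Mathlib

/-- A finite Markov Decision Problem `(S, A, T, R, γ)`: `T s a s'` is the probability of reaching
`s'` by taking action `a` from state `s`, `R s a` is the expected reward of taking `a` from `s`,
and `γ ∈ [0, 1)` is the discount factor. -/
structure MDP (S A : Type*) [Fintype S] where
  T : S → A → S → ℝ
  R : S → A → ℝ
  γ : ℝ
  T_nonneg : ∀ s a s', 0 ≤ T s a s'
  T_sum : ∀ s a, ∑ s', T s a s' = 1
  γ_nonneg : 0 ≤ γ
  γ_lt_one : γ < 1

namespace MDP

variable {S A : Type*} [Fintype S]

/-- A DMDP is an MDP whose transition function takes values in `{0, 1}`. -/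
def IsDeterministic (M : MDP S A) : Prop :=
  ∀ s a s', M.T s a s' = 0 ∨ M.T s a s' = 1

open Classical in
/-- The law of the state `s_t` at time `t` when the policy `π` is followed from `s_0 = s`:
`M.stateLaw π s t s'` is the probability of the event `s_t = s'`. -/
noncomputable def stateLaw (M : MDP S A) (π : S → A) (s : S) : ℕ → S → ℝ
  | 0 => fun s' => if s' = s then 1 else 0
  | t + 1 => fun s' => ∑ u, M.stateLaw π s t u * M.T u (π u) s'

/-- The value function `V^π(s)`: the expected infinite discounted reward when the policy `π` is
followed from `s`. The inner sum is the expectation of `R (s_t, π(s_t))`. -/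
noncomputable def value (M : MDP S A) (π : S → A) (s : S) : ℝ :=
  ∑' t : ℕ, M.γ ^ t * ∑ u, M.stateLaw π s t u * M.R u (π u)

/-- The action value function `Q^π(s, a)`: take `a` from `s`, and follow `π` thereafter. -/
noncomputable def actionValue (M : MDP S A) (π : S → A) (s : S) (a : A) : ℝ :=
  M.R s a + M.γ * ∑ s', M.T s a s' * M.value π s'

/-- The gain function `ρ^π = Q^π - V^π`. -/
noncomputable def gain (M : MDP S A) (π : S → A) (s : S) (a : A) : ℝ :=
  M.actionValue π s a - M.value π s

/-- A policy is optimal if its value function dominates that of every policy, at every state. -/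
def IsOptimal (M : MDP S A) (π : S → A) : Prop :=
  ∀ (π' : S → A) (s : S), M.value π' s ≤ M.value π s

/-- The improvable set `I^π`: the state-action pairs of positive gain. -/
def improvableSet (M : MDP S A) (π : S → A) : Set (S × A) :=
  {p | 0 < M.gain π p.1 p.2}

/-- A valid improvement set for `π`: a non-empty subset of `I^π` that holds at most one action
for each state. -/
structure IsValidImprovementSet (M : MDP S A) (π : S → A) (I : Set (S × A)) : Prop where
  subset : I ⊆ M.improvableSet π
  unique : ∀ s a a', (s, a) ∈ I → (s, a') ∈ I → a = a'
  nonempty : I.Nonempty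

/-- Max-gain action selection: each action in the improvement set maximises the gain among the
improving actions of its state (ties are broken arbitrarily). There is no restriction on the
states at which a switch is made. -/
def IsMaxGainSelection (M : MDP S A) (π : S → A) (I : Set (S × A)) : Prop :=
  ∀ s a, (s, a) ∈ I → ∀ a', (s, a') ∈ M.improvableSet π → M.gain π s a' ≤ M.gain π s a

/-- `π'` is obtained from `π` by switching to the actions given in `I`. -/
def IsSwitch (π : S → A) (I : Set (S × A)) (π' : S → A) : Prop :=
  (∀ s a, (s, a) ∈ I → π' s = a) ∧ (∀ s, (∀ a, (s, a) ∉ I) → π' s = π s)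

/-- One step of policy improvement with max-gain action selection leads from `π` to `π'`. -/
def MaxGainStep (M : MDP S A) (π π' : S → A) : Prop :=
  ∃ I : Set (S × A), M.IsValidImprovementSet π I ∧ M.IsMaxGainSelection π I ∧ IsSwitch π I π'

/-- A run of a PI algorithm with max-gain action selection, from an arbitrary initial policy
`π 0`. As long as the current policy has a non-empty improvable set, the next policy is obtained
by a max-gain improvement step, chosen in any way whatsoever (it may depend on the history or
be random); once the improvable set is empty, the algorithm has stopped, and the sequence is
continued by the final policy. -/
def IsMaxGainRun (M : MDP S A) (π : ℕ → S → A) : Prop :=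
  ∀ t, ((M.improvableSet (π t)).Nonempty → M.MaxGainStep (π t) (π (t + 1))) ∧
    (M.improvableSet (π t) = ∅ → π (t + 1) = π t)

end MDP

/-- The number `(n + 1) n² k ((k + 1)!)^((n - 1) / (k + 1))`. -/
noncomputable def maxGainBound (n k : ℕ) : ℝ :=
  ((n : ℝ) + 1) * (n : ℝ) ^ 2 * (k : ℝ) *
    ((k + 1).factorial : ℝ) ^ (((n : ℝ) - 1) / ((k : ℝ) + 1))

/-! Call two actions of a state parallel if they lead to the same successor. Their gains differ only
by their rewards, so a max-gain switch always selects an action of maximal reward among its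
parallels. Hence the set `U` of states whose current action lacks this property can only shrink, and
on `U` the policy is still the initial one. The cardinality of `U` cuts a run into at most n + 1
phases, each with `U` fixed.

Within a phase the reward of a move depends only on its two endpoints, so the value at s is
determined by the orbit of s. This orbit is a path that runs into itself: joining its last new state
v back to s gives a cycle, hence a permutation σ with σ v = s that sends every other u to itself or
to a successor of u (`exists_perm_update_iterate_eq`). Brégman's theorem bounds the number of such σ
by X = ((k+1)!)^((n-1)/(k+1)); with n choices of v and k actions at v, at most n k X values occur at
s. Values of successive policies increase strictly, so a phase holds at most n · n k X policies
(`card_le_sum_card_image_of_strictMonoOn`). The asymptotic form follows from Stirling-type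
estimates. -/

/-! ### Brégman's theorem. -/

/-- The logarithm of the geometric mean of `1, …, r`. -/
noncomputable def logFactorialMean (r : ℕ) : ℝ :=
  Real.log (r.factorial : ℝ) / r

theorem logFactorialMean_nonneg (r : ℕ) : 0 ≤ logFactorialMean r :=
  div_nonneg (Real.log_natCast_nonneg _) (Nat.cast_nonneg _)

@[simp] theorem logFactorialMean_one : logFactorialMean 1 = 0 := by
  simp [logFactorialMean]

theorem mul_logFactorialMean (r : ℕ) :
    (r : ℝ) * logFactorialMean r = Real.log (r.factorial : ℝ) := by
  rcases Nat.eq_zero_or_pos r with rfl | h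
  · simp
  · have : (r : ℝ) ≠ 0 := by positivity
    unfold logFactorialMean
    field_simp

theorem log_factorial_succ (q : ℕ) :
    Real.log ((q + 1).factorial : ℝ) = Real.log ((q : ℝ) + 1) + Real.log (q.factorial : ℝ) := by
  rw [Nat.factorial_succ]
  push_cast
  exact Real.log_mul (by positivity) (by positivity)

theorem logFactorialMean_mono : Monotone logFactorialMean := by
  refine monotone_nat_of_le_succ fun r => ?_
  rcases Nat.eq_zero_or_pos r with rfl | h
  · simp [logFactorialMean]
  · have hr : (0 : ℝ) < r := by positivity
    unfold logFactorialMean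
    rw [div_le_div_iff₀ hr (by positivity), log_factorial_succ]
    have h1 : Real.log (r.factorial : ℝ) ≤ r * Real.log ((r : ℝ) + 1) := by
      rw [← Real.log_pow]
      refine Real.log_le_log (by positivity) ?_
      exact_mod_cast (Nat.factorial_le_pow r).trans (Nat.pow_le_pow_left (Nat.le_succ r) r)
    push_cast
    nlinarith

/-- An entropy bound: for uniform σ in `S`, the variable `h σ` takes at most |N| values, so its
entropy is at most log |N|. It follows from log x ≤ x - 1 at x = |S| / (|N| p), with p the size of
the fibre of σ. -/
theorem card_mul_log_card_le {ι κ : Type*} [DecidableEq κ] (S : Finset ι) (N : Finset κ)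
    (h : ι → κ) (hN : ∀ σ ∈ S, h σ ∈ N) :
    (S.card : ℝ) * Real.log S.card ≤
      ∑ σ ∈ S, (Real.log N.card + Real.log (S.filter fun τ => h τ = h σ).card) := by
  rcases S.eq_empty_or_nonempty with rfl | hS
  · simp
  have hP : (0 : ℝ) < S.card := by exact_mod_cast hS.card_pos
  have hr : (0 : ℝ) < N.card := by
    obtain ⟨σ, hσ⟩ := hS
    exact_mod_cast Finset.card_pos.2 ⟨_, hN σ hσ⟩
  set p : κ → ℝ := fun k => ((S.filter fun τ => h τ = k).card : ℝ) with hp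
  have hpos : ∀ σ ∈ S, 0 < p (h σ) := fun σ hσ => by
    have : 0 < (S.filter fun τ => h τ = h σ).card :=
      Finset.card_pos.2 ⟨σ, Finset.mem_filter.2 ⟨hσ, rfl⟩⟩
    simpa only [hp, Nat.cast_pos] using this
  have hterm : ∀ σ ∈ S, Real.log S.card - (Real.log N.card + Real.log (p (h σ))) ≤
      S.card / N.card * (p (h σ))⁻¹ - 1 := fun σ hσ => by
    have hq := hpos σ hσ
    have := Real.log_le_sub_one_of_pos (x := S.card / N.card * (p (h σ))⁻¹) (by positivity)
    rw [Real.log_mul (by positivity) (by positivity), Real.log_div hP.ne' hr.ne',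
      Real.log_inv] at this
    linarith
  have hinv : ∑ σ ∈ S, (p (h σ))⁻¹ ≤ N.card := by
    rw [← Finset.sum_fiberwise_of_maps_to hN]
    calc ∑ k ∈ N, ∑ σ ∈ S with h σ = k, (p (h σ))⁻¹
        ≤ ∑ k ∈ N, (1 : ℝ) := Finset.sum_le_sum fun k _ => by
          rw [Finset.sum_congr rfl (g := fun _ => (p k)⁻¹)
            (fun σ hσ => by rw [(Finset.mem_filter.1 hσ).2])]
          rw [Finset.sum_const, nsmul_eq_mul]
          exact mul_inv_le_one
      _ = N.card := by simp
  have hsum := Finset.sum_le_sum hterm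
  rw [Finset.sum_sub_distrib, Finset.sum_sub_distrib, ← Finset.mul_sum] at hsum
  simp only [Finset.sum_const, nsmul_eq_mul, mul_one] at hsum
  have : (S.card : ℝ) / N.card * ∑ σ ∈ S, (p (h σ))⁻¹ ≤ S.card := by
    calc _ ≤ (S.card : ℝ) / N.card * N.card := by gcongr
      _ = S.card := by field_simp
  linarith

open Classical in
/-- The bijections `σ` such that `σ i ∈ N i` for all `i`. -/
noncomputable def restrictedEquivs {α β : Type*} [Fintype α] [Fintype β] (N : α → Finset β) :
    Finset (α ≃ β) :=
  Finset.univ.filter fun σ => ∀ i, σ i ∈ N i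

theorem mem_restrictedEquivs {α β : Type*} [Fintype α] [Fintype β] {N : α → Finset β}
    {σ : α ≃ β} : σ ∈ restrictedEquivs N ↔ ∀ i, σ i ∈ N i := by
  simp [restrictedEquivs]

open Classical in
/-- Fixing one value of a bijection leaves a bijection of the complements. -/
theorem card_filter_equiv_apply_eq_le {α β : Type*} [Fintype α] [Fintype β]
    (N : α → Finset β) (i : α) (k : β) :
    ((restrictedEquivs N).filter fun σ => σ i = k).card ≤
      (restrictedEquivs fun j : {j // j ≠ i} => (N j.1).subtype (· ≠ k)).card := by
  refine Finset.card_le_card_of_forall_subsingleton (fun σ τ => ∀ j, (τ j : β) = σ j) ?_ ?_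
  · intro σ hσ
    simp only [Finset.mem_filter, mem_restrictedEquivs] at hσ
    refine ⟨σ.subtypeEquiv fun a => ?_, ?_, fun j => rfl⟩
    · rw [← hσ.2]; simp
    · simp only [mem_restrictedEquivs, Finset.mem_subtype]
      exact fun j => hσ.1 j
  · intro τ _ σ hσ σ' hσ'
    simp only [Finset.mem_filter] at hσ hσ'
    ext j
    by_cases hj : j = i
    · rw [hj, hσ.1.2, hσ'.1.2]
    · exact (hσ.2 ⟨j, hj⟩).symm.trans (hσ'.2 ⟨j, hj⟩)

open Classical in
-- With r = |N| and L = `logFactorialMean`, exactly r - 1 of the points k ≠ x lie in `N`, and log r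
-- + (r-1) L(r-1) = log r! = r L(r). This identity makes the induction for Brégman's theorem close
-- exactly.
theorem sum_logFactorialMean_erase {β : Type*} [Fintype β] (N : Finset β) (x : β) (hx : x ∈ N) :
    Real.log N.card +
      ∑ k ∈ Finset.univ.erase x, logFactorialMean (if k ∈ N then N.card - 1 else N.card) =
    Fintype.card β * logFactorialMean N.card := by
  have hsplit : ∑ k : β, logFactorialMean (if k ∈ N then N.card - 1 else N.card) =
      N.card * logFactorialMean (N.card - 1) +
        (Fintype.card β - N.card) * logFactorialMean N.card := by
    rw [← Finset.sum_add_sum_compl N]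
    congr 1
    · rw [Finset.sum_congr rfl (g := fun _ => logFactorialMean (N.card - 1))
        (fun k hk => by rw [if_pos hk]), Finset.sum_const, nsmul_eq_mul]
    · rw [Finset.sum_congr rfl (g := fun _ => logFactorialMean N.card)
        (fun k hk => by rw [if_neg (Finset.mem_compl.1 hk)]), Finset.sum_const, nsmul_eq_mul,
        Finset.card_compl, Nat.cast_sub (Finset.card_le_univ N)]
  rw [← Finset.add_sum_erase _ _ (Finset.mem_univ x), if_pos hx] at hsplit
  obtain ⟨q, hq⟩ : ∃ q, N.card = q + 1 :=
    ⟨N.card - 1, by have := Finset.card_pos.2 ⟨x, hx⟩; omega⟩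
  rw [hq] at hsplit ⊢
  have h1 := mul_logFactorialMean (q + 1)
  have h2 := mul_logFactorialMean q
  rw [log_factorial_succ] at h1
  simp only [Nat.add_sub_cancel] at hsplit ⊢
  push_cast at *
  linarith

open Classical in
-- Schrijver's averaging argument: the entropy bound is applied to the evaluation at each point i,
-- the fibres are bounded by induction on the domain with i removed, and the results are added over
-- all i.
theorem log_card_restricted_equiv_le_aux (n : ℕ) :
    ∀ {α : Type*} {β : Type*} [Fintype α] [Fintype β] (N : α → Finset β), Fintype.card α = n →
    Real.log (restrictedEquivs N).card ≤
      ∑ i, logFactorialMean (N i).card := by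
  induction n with
  | zero =>
    intro α β _ _ N hα
    have := Fintype.card_eq_zero_iff.1 hα
    have h1 : (restrictedEquivs N).card ≤ 1 :=
      Finset.card_le_one.2 fun σ _ τ _ => Equiv.ext fun i => isEmptyElim i
    refine (Real.log_nonpos (Nat.cast_nonneg _) (by exact_mod_cast h1)).trans
      (Finset.sum_nonneg fun i _ => logFactorialMean_nonneg _)
  | succ n ih =>
    intro α β _ _ N hα
    set S := restrictedEquivs N
    rcases S.eq_empty_or_nonempty with hS | hS
    -- Here `Real.log 0 = 0`.
    · rw [hS]
      simpa using Finset.sum_nonneg fun i _ => logFactorialMean_nonneg _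
    have hP : (0 : ℝ) < S.card := by exact_mod_cast hS.card_pos
    have hmem : ∀ σ ∈ S, ∀ i, σ i ∈ N i := fun σ hσ => mem_restrictedEquivs.1 hσ
    have hβ : Fintype.card β = n + 1 := by
      obtain ⟨σ, _⟩ := hS
      rw [← Fintype.card_congr σ, hα]
    have hfib : ∀ σ ∈ S, ∀ i,
        Real.log (S.filter fun τ => τ i = σ i).card ≤
          ∑ j ∈ Finset.univ.erase i,
            logFactorialMean (if σ i ∈ N j then (N j).card - 1 else (N j).card) := by
      intro σ hσ i
      have hc : Fintype.card {j // j ≠ i} = n := by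
        rw [Fintype.card_subtype_compl, Fintype.card_subtype_eq, hα]
        rfl
      have hpos : 0 < (S.filter fun τ => τ i = σ i).card :=
        Finset.card_pos.2 ⟨σ, Finset.mem_filter.2 ⟨hσ, rfl⟩⟩
      refine (Real.log_le_log (by exact_mod_cast hpos)
        (Nat.cast_le.2 (card_filter_equiv_apply_eq_le N i (σ i)))).trans ?_
      have hi := ih (fun j : {j // j ≠ i} => (N j.1).subtype (· ≠ σ i)) hc
      refine le_trans hi (le_of_eq ?_)
      rw [Finset.sum_subtype (Finset.univ.erase i) (p := (· ≠ i)) (by simp)]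
      refine Finset.sum_congr rfl fun j _ => ?_
      congr 1
      rw [Finset.card_subtype, Finset.filter_ne']
      exact Finset.card_erase_eq_ite
    have hmain : ((n : ℝ) + 1) * (S.card * Real.log S.card) ≤
        ∑ σ ∈ S, ((n : ℝ) + 1) * ∑ i, logFactorialMean (N i).card := by
      calc ((n : ℝ) + 1) * (S.card * Real.log S.card)
          = ∑ i : α, (S.card * Real.log S.card) := by
            rw [Finset.sum_const, Finset.card_univ, hα, nsmul_eq_mul]
            push_cast
            rfl
        _ ≤ ∑ i : α, ∑ σ ∈ S,
            (Real.log (N i).card + Real.log (S.filter fun τ => τ i = σ i).card) :=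
            Finset.sum_le_sum fun i _ =>
              card_mul_log_card_le S (N i) (fun σ => σ i) fun σ hσ => hmem σ hσ i
        _ = ∑ σ ∈ S, ∑ i : α,
            (Real.log (N i).card + Real.log (S.filter fun τ => τ i = σ i).card) :=
            Finset.sum_comm
        _ ≤ _ := Finset.sum_le_sum fun σ hσ => ?_
      calc ∑ i : α, (Real.log (N i).card + Real.log (S.filter fun τ => τ i = σ i).card)
          ≤ ∑ i : α, (Real.log (N i).card + ∑ j ∈ Finset.univ.erase i,
            logFactorialMean (if σ i ∈ N j then (N j).card - 1 else (N j).card)) :=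
            Finset.sum_le_sum fun i _ => by linarith [hfib σ hσ i]
        _ = ∑ j : α, (Real.log (N j).card + ∑ i ∈ Finset.univ.erase j,
            logFactorialMean (if σ i ∈ N j then (N j).card - 1 else (N j).card)) := by
            rw [Finset.sum_add_distrib, Finset.sum_add_distrib]
            congr 1
            refine Finset.sum_comm' fun i j => ?_
            simp [eq_comm]
        _ = ∑ j : α, ((n : ℝ) + 1) * logFactorialMean (N j).card :=
            Finset.sum_congr rfl fun j _ => by
              have := sum_logFactorialMean_erase (N j) (σ j) (hmem σ hσ j)
              rw [hβ] at this
              push_cast at this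
              rw [← this]
              congr 1
              -- Reindexing by k = σ i turns i ≠ j into k ≠ σ j.
              refine Finset.sum_equiv σ (fun i => by simp) fun i _ => rfl
        _ = _ := by rw [Finset.mul_sum]
    rw [Finset.sum_const, nsmul_eq_mul] at hmain
    have hn : (0 : ℝ) < ((n : ℝ) + 1) * S.card := by positivity
    refine le_of_mul_le_mul_left ?_ hn
    linarith

open Classical in
/-- **Brégman's theorem**, in logarithmic form: a bound for the number of bijections whose values
are restricted to prescribed sets. -/
theorem log_card_restricted_equiv_le {α β : Type*} [Fintype α] [Fintype β] (N : α → Finset β) :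
    Real.log (restrictedEquivs N).card ≤
      ∑ i, logFactorialMean (N i).card :=
  log_card_restricted_equiv_le_aux _ N rfl

open Classical in
/-- Permutations with one prescribed value, whose other values are restricted to sets of at most
`d` elements. -/
theorem card_restricted_perm_le {α : Type*} [Fintype α] (N : α → Finset α) (d : ℕ)
    (hd : ∀ u, (N u).card ≤ d) (v s : α) :
    ((Finset.univ.filter fun σ : Equiv.Perm α => σ v = s ∧ ∀ u, u ≠ v → σ u ∈ N u).card : ℝ) ≤
      (d.factorial : ℝ) ^ (((Fintype.card α : ℝ) - 1) / d) := by
  set S := Finset.univ.filter fun σ : Equiv.Perm α => σ v = s ∧ ∀ u, u ≠ v → σ u ∈ N u with hS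
  -- The prescribed value is a singleton constraint; it contributes log 1! = 0, whence n - 1 rather
  -- than n in the exponent.
  have hS' : S = restrictedEquivs (Function.update N v {s}) := by
    refine Finset.filter_congr fun σ _ => ⟨fun h u => ?_, fun h => ⟨?_, fun u hu => ?_⟩⟩
    · by_cases hu : u = v
      · subst hu; simp [h.1]
      · rw [Function.update_of_ne hu]; exact h.2 u hu
    · simpa using h v
    · have := h u
      rwa [Function.update_of_ne hu] at this
  have hf : (0 : ℝ) < (d.factorial : ℝ) := by positivity
  rcases S.eq_empty_or_nonempty with h0 | h0
  · rw [h0]; simpa using Real.rpow_nonneg hf.le _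
  have hP : (0 : ℝ) < S.card := by exact_mod_cast h0.card_pos
  rw [← Real.log_le_log_iff hP (by positivity), Real.log_rpow hf, hS']
  refine (log_card_restricted_equiv_le _).trans ?_
  rw [← Finset.add_sum_erase _ _ (Finset.mem_univ v)]
  simp only [Function.update_self, Finset.card_singleton, logFactorialMean_one, zero_add]
  calc _ ≤ ∑ u ∈ Finset.univ.erase v, logFactorialMean d := Finset.sum_le_sum fun u hu => by
        rw [Function.update_of_ne (Finset.ne_of_mem_erase hu)]
        exact logFactorialMean_mono (hd u)
    _ = _ := by
        rw [Finset.sum_const, nsmul_eq_mul, Finset.card_erase_of_mem (Finset.mem_univ v),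
          Finset.card_univ, Nat.cast_pred (Fintype.card_pos_iff.2 ⟨v⟩), logFactorialMean]
        ring

/-! ### Stirling-type estimates and the asymptotic form of the bound. -/

theorem log_factorial_le (m : ℕ) (hm : 1 ≤ m) :
    Real.log (m.factorial : ℝ) ≤ 1 + Real.log m + m * Real.log m - m := by
  induction m, hm using Nat.le_induction with
  | base => simp
  | succ m hm ih =>
    have h0 : (0 : ℝ) < m := by exact_mod_cast hm
    have h := Real.log_le_sub_one_of_pos (x := (m : ℝ) / (m + 1)) (by positivity)
    rw [Real.log_div (by positivity) (by positivity)] at h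
    have h2 : (m : ℝ) / (m + 1) - 1 = -(1 / (m + 1)) := by field_simp; ring
    have h3 : 1 ≤ ((m : ℝ) + 1) * (Real.log (m + 1) - Real.log m) := by
      rw [h2] at h
      have : 1 / ((m : ℝ) + 1) ≤ Real.log (m + 1) - Real.log m := by linarith
      rw [div_le_iff₀ (by positivity)] at this
      linarith
    rw [log_factorial_succ]
    push_cast
    linarith

theorem le_log_factorial (m : ℕ) (hm : 1 ≤ m) :
    m * Real.log m - m ≤ Real.log (m.factorial : ℝ) := by
  have h0 : (0 : ℝ) < m := by exact_mod_cast hm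
  have h := Real.pow_div_factorial_le_exp (m : ℝ) h0.le m
  have := Real.log_le_log (by positivity) h
  rw [Real.log_exp, Real.log_div (by positivity) (by positivity), Real.log_pow] at this
  linarith

theorem exp_logFactorialMean_le (k : ℕ) (hk : 2 ≤ k) :
    Real.exp (logFactorialMean (k + 1)) ≤
      (1 + 10 * (Real.log k / k)) * ((k : ℝ) / Real.exp 1) := by
  have hk' : (2 : ℝ) ≤ k := by exact_mod_cast hk
  set m : ℝ := (k : ℝ) + 1 with hm
  have hm0 : 0 < m := by positivity
  have hlogm : 0 ≤ Real.log m := Real.log_nonneg (by linarith)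
  have hb : logFactorialMean (k + 1) ≤ Real.log m - 1 + (1 + Real.log m) / m := by
    have h := log_factorial_le (k + 1) (by omega)
    rw [← mul_logFactorialMean] at h
    push_cast at h
    rw [← hm] at h
    refine le_of_mul_le_mul_left (h.trans (le_of_eq ?_)) hm0
    field_simp
    ring
  have hx1 : (1 + Real.log m) / m ≤ 1 := by
    rw [div_le_one hm0]
    linarith [Real.log_le_sub_one_of_pos hm0]
  have hx0 : 0 ≤ (1 + Real.log m) / m := by positivity
  set x := (1 + Real.log m) / m with hx
  have hexp : Real.exp x ≤ 1 + 2 * x := by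
    have := Real.abs_exp_sub_one_sub_id_le (x := x) (by rwa [abs_of_nonneg hx0])
    have := (abs_le.1 this).2
    nlinarith
  have hlog2 : Real.log m ≤ 2 * Real.log k := by
    rw [← Real.log_rpow (by positivity)]
    refine Real.log_le_log hm0 ?_
    norm_num
    nlinarith
  have hlogk : 1 / 2 ≤ Real.log k :=
    (by linarith [Real.log_two_gt_d9] : (1 : ℝ) / 2 ≤ Real.log 2).trans
      (Real.log_le_log (by norm_num) hk')
  calc Real.exp (logFactorialMean (k + 1)) ≤ Real.exp (Real.log m - 1 + x) :=
        Real.exp_le_exp.2 hb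
    _ = m / Real.exp 1 * Real.exp x := by
        rw [Real.exp_add, Real.exp_sub, Real.exp_log hm0]
    _ ≤ m / Real.exp 1 * (1 + 2 * x) := by gcongr
    _ = (m + 2 * (1 + Real.log m)) / Real.exp 1 := by
        rw [hx]; field_simp
    _ ≤ (k + 10 * Real.log k) / Real.exp 1 := by
        -- The constant 10: 3 + 2 log m ≤ 3 + 4 log k, and 3 ≤ 6 log k because log k ≥ 1/2.
        refine div_le_div_of_nonneg_right ?_ (Real.exp_pos 1).le
        linarith
    _ = _ := by field_simp

/-- With Y = ((k+1)!)^(1/(k+1)), the factorial power is Y^(n-1); the factor k ≤ e Y supplies the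
missing Y. -/
theorem maxGainBound_le (n k : ℕ) (hn : 2 ≤ n) (hk : 2 ≤ k) :
    maxGainBound n k ≤ 2 * Real.exp 1 * (n : ℝ) ^ 3 *
      ((1 + 10 * (Real.log (k : ℝ) / (k : ℝ))) * ((k : ℝ) / Real.exp 1)) ^ n := by
  have hn' : (2 : ℝ) ≤ n := by exact_mod_cast hn
  have hk' : (2 : ℝ) ≤ k := by exact_mod_cast hk
  set Y := Real.exp (logFactorialMean (k + 1)) with hY
  have hpow : ((k + 1).factorial : ℝ) ^ (((n : ℝ) - 1) / ((k : ℝ) + 1)) * Y = Y ^ n := by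
    rw [Real.rpow_def_of_pos (by positivity), hY, ← Real.exp_add, ← Real.exp_nat_mul,
      logFactorialMean]
    congr 1
    push_cast
    field_simp
    ring
  have hkY : (k : ℝ) ≤ Real.exp 1 * Y := by
    rw [hY, ← Real.exp_add]
    have h := le_log_factorial (k + 1) (by omega)
    rw [← mul_logFactorialMean] at h
    push_cast at h
    have h' : Real.log ((k : ℝ) + 1) ≤ 1 + logFactorialMean (k + 1) := by
      refine le_of_mul_le_mul_left (a := (k : ℝ) + 1) ?_ (by positivity)
      linarith
    rw [Real.log_le_iff_le_exp (by positivity)] at h'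
    linarith
  set X := ((k + 1).factorial : ℝ) ^ (((n : ℝ) - 1) / ((k : ℝ) + 1)) with hX
  have hX0 : 0 < X := by positivity
  calc maxGainBound n k = ((n : ℝ) + 1) * (n : ℝ) ^ 2 * (k : ℝ) * X := rfl
    _ ≤ (2 * n) * (n : ℝ) ^ 2 * (Real.exp 1 * Y) * X := by
        gcongr
        linarith
    _ = 2 * Real.exp 1 * (n : ℝ) ^ 3 * (X * Y) := by ring
    _ = 2 * Real.exp 1 * (n : ℝ) ^ 3 * Y ^ n := by rw [hpow]
    _ ≤ _ := by
        gcongr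
        exact exp_logFactorialMean_le k hk

/-! ### Discounted sums, orbits of self-maps and chains of functions. -/

/-- At a maximum point m of `D`, D m ≤ γ D m forces D m ≤ 0. Applied to differences of values, this
replaces unrolling the Bellman equation. -/
theorem nonpos_of_le_mul_apply {S : Type*} [Finite S] {γ : ℝ} (hγ : γ < 1) (f : S → S) (D : S → ℝ)
    (h : ∀ s, D s ≤ γ * D (f s)) (h0 : 0 ≤ γ) (s : S) : D s ≤ 0 := by
  have : Nonempty S := ⟨s⟩
  obtain ⟨m, hm⟩ := Finite.exists_max D
  have h1 : D m ≤ γ * D m := (h m).trans (mul_le_mul_of_nonneg_left (hm _) h0)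
  have h2 : D m ≤ 0 := by nlinarith
  exact (hm s).trans h2

theorem summable_discounted {S : Type*} [Finite S] {γ : ℝ} (h0 : 0 ≤ γ) (h1 : γ < 1) (f : S → S)
    (r : S → ℝ) (s : S) : Summable fun t : ℕ => γ ^ t * r (f^[t] s) := by
  have : Nonempty S := ⟨s⟩
  obtain ⟨m, hm⟩ := Finite.exists_max fun s => |r s|
  refine Summable.of_norm_bounded (g := fun t : ℕ => γ ^ t * |r m|)
    ((summable_geometric_of_lt_one h0 h1).mul_right _) fun t => ?_
  rw [Real.norm_eq_abs, abs_mul, abs_of_nonneg (pow_nonneg h0 t)]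
  exact mul_le_mul_of_nonneg_left (hm _) (pow_nonneg h0 t)

/-- The orbit of a point under a self-map of a finite type is the orbit under a permutation changed
at a single point `v`, where the permutation agrees with the map or fixes the point elsewhere. -/
theorem exists_perm_update_iterate_eq {S : Type*} [Finite S] [DecidableEq S] (f : S → S) (s : S) :
    ∃ (v : S) (σ : Equiv.Perm S), σ v = s ∧ (∀ u, u ≠ v → σ u = u ∨ σ u = f u) ∧
      ∀ j, (Function.update σ v (f v))^[j] s = f^[j] s := by
  classical
  -- The least such m is the index of the last new point of the orbit, which will be v.
  have hex : ∃ m, ∃ i ≤ m, f^[m + 1] s = f^[i] s := by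
    obtain ⟨a, b, hab, h⟩ := Finite.exists_ne_map_eq_of_infinite fun j : ℕ => f^[j] s
    rcases lt_or_gt_of_ne hab with hlt | hlt
    · exact ⟨b - 1, a, by omega, by rw [Nat.sub_add_cancel (by omega)]; exact h.symm⟩
    · exact ⟨a - 1, b, by omega, by rw [Nat.sub_add_cancel (by omega)]; exact h⟩
  set m := Nat.find hex with hm
  obtain ⟨i₀, hi₀, hcyc⟩ := Nat.find_spec hex
  have hne : ∀ i j, i < j → j ≤ m → f^[i] s ≠ f^[j] s := fun i j hij hj h =>
    Nat.find_min hex (m := j - 1) (by omega)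
      ⟨i, by omega, by rw [Nat.sub_add_cancel (by omega)]; exact h.symm⟩
  have hinj : ∀ i j, i ≤ m → j ≤ m → f^[i] s = f^[j] s → i = j := fun i j hi hj h => by
    rcases lt_trichotomy i j with hlt | heq | hlt
    · exact (hne i j hlt hj h).elim
    · exact heq
    · exact (hne j i hlt hi h.symm).elim
  set l : List S := (List.range (m + 1)).map fun j => f^[j] s with hl
  have hlen : l.length = m + 1 := by simp [hl]
  have hnd : l.Nodup := by
    refine List.Nodup.map_on (fun i hi j hj h => ?_) List.nodup_range
    rw [List.mem_range] at hi hj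
    exact hinj i j (by omega) (by omega) h
  have hget : ∀ (i : ℕ) (hi : i < l.length), l[i] = f^[i] s := fun i hi => by
    simp only [hl, List.getElem_map, List.getElem_range]
  have happ : ∀ i, i ≤ m → l.formPerm (f^[i] s) = f^[(i + 1) % (m + 1)] s := fun i hi => by
    have := List.formPerm_apply_getElem l hnd i (by omega)
    simpa only [hget, hlen] using this
  have hlast : l.formPerm (f^[m] s) = s := by rw [happ m le_rfl]; simp
  have hlt : ∀ i, i < m → l.formPerm (f^[i] s) = f^[i + 1] s := fun i hi => by
    rw [happ i hi.le, Nat.mod_eq_of_lt (by omega)]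
  refine ⟨f^[m] s, l.formPerm, hlast, fun u hu => ?_, fun j => ?_⟩
  · by_cases hul : u ∈ l
    · obtain ⟨i, hi, rfl⟩ := List.mem_map.1 hul
      rw [List.mem_range] at hi
      have hi' : i < m := lt_of_le_of_ne (by omega) fun h => hu (by rw [h])
      exact Or.inr (by rw [hlt i hi', Function.iterate_succ_apply'])
    · exact Or.inl (List.formPerm_apply_of_notMem hul)
  · have horb : ∀ j, ∃ i ≤ m, f^[j] s = f^[i] s := fun j => by
      induction j with
      | zero => exact ⟨0, by omega, rfl⟩
      | succ j ih =>
        obtain ⟨i, hi, h⟩ := ih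
        rw [Function.iterate_succ_apply', h, ← Function.iterate_succ_apply' f]
        rcases hi.lt_or_eq with h' | h'
        · exact ⟨i + 1, h', rfl⟩
        · exact ⟨i₀, hi₀, by rw [h', hcyc]⟩
    induction j with
    | zero => rfl
    | succ j ih =>
      rw [Function.iterate_succ_apply', ih, Function.iterate_succ_apply']
      obtain ⟨i, hi, h⟩ := horb j
      rw [h]
      rcases hi.lt_or_eq with h' | h'
      · rw [Function.update_of_ne (hne i m h' le_rfl), hlt i h', Function.iterate_succ_apply']
      · rw [h', Function.update_self]

/-- A strictly increasing family of functions on `S` has at most as many members as there are pairs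
of a point and a value attained there. -/
theorem card_le_sum_card_image_of_strictMonoOn {S : Type*} [Fintype S] [Nonempty S] (T : Finset ℕ)
    (V : ℕ → S → ℝ) (hV : StrictMonoOn V T) :
    T.card ≤ ∑ s, (T.image fun t => V t s).card := by
  classical
  set F : S → Finset ℝ := fun s => T.image fun t => V t s with hF
  have hmem : ∀ t ∈ T, ∀ s, V t s ∈ F s := fun t ht s => Finset.mem_image_of_mem _ ht
  -- The rank of t: over all s, the number of attained values below `V t s`. It increases strictly
  -- with t and stays below the total.
  set h : ℕ → ℕ := fun t => ∑ s, ((F s).filter (· < V t s)).card with hh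
  have hmono : StrictMonoOn h T := fun t ht t' ht' htt => by
    have hlt := hV ht ht' htt
    obtain ⟨hle, s, hs⟩ := Pi.lt_def.1 hlt
    have hsub : ∀ s, (F s).filter (· < V t s) ⊆ (F s).filter (· < V t' s) := fun s =>
      Finset.monotone_filter_right _ fun x _ hx => lt_of_lt_of_le hx (hle s)
    refine Finset.sum_lt_sum (fun s _ => Finset.card_le_card (hsub s)) ⟨s, Finset.mem_univ s, ?_⟩
    refine Finset.card_lt_card ((Finset.ssubset_iff_of_subset (hsub s)).2 ⟨V t s, ?_, ?_⟩)
    · exact Finset.mem_filter.2 ⟨hmem t ht s, hs⟩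
    · simp
  have hlt : ∀ t ∈ T, h t < ∑ s, (F s).card := fun t ht =>
    Finset.sum_lt_sum_of_nonempty Finset.univ_nonempty fun s _ =>
      Finset.card_lt_card (Finset.filter_ssubset.2 ⟨V t s, hmem t ht s, lt_irrefl _⟩)
  calc T.card ≤ (Finset.range (∑ s, (F s).card)).card :=
        Finset.card_le_card_of_injOn h (fun t ht => by simpa using hlt t ht) hmono.injOn
    _ = _ := Finset.card_range _

/-! ### Deterministic MDPs and policy improvement. -/

namespace MDP

variable {S A : Type*} [Fintype S]

/-- `next s a` is the state that is reached with certainty by taking `a` from `s`. -/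
def IsSuccessor (M : MDP S A) (next : S → A → S) : Prop :=
  ∀ (s : S) (a : A) (V : S → ℝ), ∑ s', M.T s a s' * V s' = V (next s a)

theorem IsDeterministic.exists_isSuccessor {M : MDP S A} (hM : M.IsDeterministic) :
    ∃ next, M.IsSuccessor next := by
  classical
  have h : ∀ s a, ∃ s', ∀ V : S → ℝ, ∑ u, M.T s a u * V u = V s' := fun s a => by
    have h1 : ∃ s', M.T s a s' = 1 := by
      by_contra! hne
      have := M.T_sum s a
      rw [Finset.sum_eq_zero fun u _ => (hM s a u).resolve_right (hne u)] at this
      exact zero_ne_one this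
    obtain ⟨s', hs'⟩ := h1
    have hsum := M.T_sum s a
    rw [← Finset.add_sum_erase _ _ (Finset.mem_univ s'), hs'] at hsum
    have h0 := (Finset.sum_eq_zero_iff_of_nonneg fun u _ => M.T_nonneg s a u).1
      (by linarith : ∑ u ∈ Finset.univ.erase s', M.T s a u = 0)
    refine ⟨s', fun V => ?_⟩
    rw [← Finset.add_sum_erase _ _ (Finset.mem_univ s'), hs', one_mul,
      Finset.sum_eq_zero fun u hu => by rw [h0 u hu, zero_mul], add_zero]
  choose next hnext using h
  exact ⟨next, hnext⟩

variable {M : MDP S A} {next : S → A → S}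

theorem IsSuccessor.sum_stateLaw_mul (h : M.IsSuccessor next) (π : S → A) (s : S) (t : ℕ)
    (g : S → ℝ) : ∑ u, M.stateLaw π s t u * g u = g ((fun u => next u (π u))^[t] s) := by
  classical
  induction t generalizing g with
  | zero =>
    simp only [stateLaw, ite_mul, one_mul, zero_mul, Function.iterate_zero, id_eq]
    convert Finset.sum_ite_eq' Finset.univ s g using 1
    simp
  | succ t ih =>
    simp only [stateLaw, Finset.sum_mul]
    rw [Finset.sum_comm]
    simp only [mul_assoc, ← Finset.mul_sum]
    rw [Finset.sum_congr rfl fun u _ => by rw [h u (π u) g], ih fun u => g (next u (π u)),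
      Function.iterate_succ_apply']

theorem IsSuccessor.value_eq (h : M.IsSuccessor next) (π : S → A) (s : S) :
    M.value π s = ∑' t : ℕ, M.γ ^ t *
      M.R ((fun u => next u (π u))^[t] s) (π ((fun u => next u (π u))^[t] s)) := by
  unfold value
  exact tsum_congr fun t => by rw [h.sum_stateLaw_mul π s t fun u => M.R u (π u)]

theorem IsSuccessor.value_eq_add (h : M.IsSuccessor next) (π : S → A) (s : S) :
    M.value π s = M.R s (π s) + M.γ * M.value π (next s (π s)) := by
  rw [h.value_eq, h.value_eq, (summable_discounted M.γ_nonneg M.γ_lt_one _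
    (fun u => M.R u (π u)) s).tsum_eq_zero_add, ← tsum_mul_left]
  simp only [pow_zero, one_mul, Function.iterate_zero, id_eq, pow_succ', mul_assoc,
    Function.iterate_succ_apply]

theorem IsSuccessor.gain_eq (h : M.IsSuccessor next) (π : S → A) (s : S) (a : A) :
    M.gain π s a = M.R s a + M.γ * M.value π (next s a) - M.value π s := by
  rw [gain, actionValue, h s a (M.value π)]

theorem IsSuccessor.value_le_of_gain_nonneg (h : M.IsSuccessor next) (π π' : S → A)
    (hg : ∀ s, 0 ≤ M.gain π s (π' s)) (s : S) : M.value π s ≤ M.value π' s := by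
  refine sub_nonpos.1 (nonpos_of_le_mul_apply M.γ_lt_one (fun s => next s (π' s))
    (fun s => M.value π s - M.value π' s) (fun s => ?_) M.γ_nonneg s)
  have h1 := hg s
  rw [h.gain_eq] at h1
  rw [h.value_eq_add π' s]
  linarith

theorem IsSuccessor.value_lt (h : M.IsSuccessor next) (π π' : S → A)
    (hg : ∀ s, 0 ≤ M.gain π s (π' s)) {s : S} (hs : 0 < M.gain π s (π' s)) :
    M.value π < M.value π' := by
  have hle := h.value_le_of_gain_nonneg π π' hg
  refine Pi.lt_def.2 ⟨hle, s, ?_⟩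
  have h2 := mul_le_mul_of_nonneg_left (hle (next s (π' s))) M.γ_nonneg
  rw [h.gain_eq] at hs
  rw [h.value_eq_add π' s]
  linarith

theorem IsSuccessor.isOptimal (h : M.IsSuccessor next) (π : S → A)
    (hπ : M.improvableSet π = ∅) : M.IsOptimal π := fun π' s => by
  refine sub_nonpos.1 (nonpos_of_le_mul_apply M.γ_lt_one (fun s => next s (π' s))
    (fun s => M.value π' s - M.value π s) (fun s => ?_) M.γ_nonneg s)
  have h1 : M.gain π s (π' s) ≤ 0 := not_lt.1 fun hlt =>
    (Set.eq_empty_iff_forall_notMem.1 hπ (s, π' s)) hlt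
  rw [h.gain_eq] at h1
  rw [h.value_eq_add π' s]
  linarith

theorem IsSuccessor.gain_self (h : M.IsSuccessor next) (π : S → A) (s : S) :
    M.gain π s (π s) = 0 := by
  rw [h.gain_eq, ← h.value_eq_add, sub_self]

/-- No parallel action, with the same successor state, has a larger reward. -/
def IsParallelMax (M : MDP S A) (next : S → A → S) (s : S) (a : A) : Prop :=
  ∀ a', next s a' = next s a → M.R s a' ≤ M.R s a

theorem MaxGainStep.switch {π π' : S → A} (hs : M.MaxGainStep π π') (s : S) :
    π' s = π s ∨ (0 < M.gain π s (π' s) ∧ ∀ a, M.gain π s a ≤ M.gain π s (π' s)) := by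
  obtain ⟨I, hI, hmax, hsw⟩ := hs
  by_cases hex : ∃ a, (s, a) ∈ I
  · obtain ⟨a, ha⟩ := hex
    rw [hsw.1 s a ha]
    have hpos : 0 < M.gain π s a := hI.subset ha
    refine Or.inr ⟨hpos, fun a' => ?_⟩
    by_cases h' : 0 < M.gain π s a'
    · exact hmax s a ha a' h'
    · linarith
  · exact Or.inl (hsw.2 s (not_exists.1 hex))

theorem MaxGainStep.exists_gain_pos {π π' : S → A} (hs : M.MaxGainStep π π') :
    ∃ s, 0 < M.gain π s (π' s) := by
  obtain ⟨I, hI, hmax, hsw⟩ := hs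
  obtain ⟨⟨s, a⟩, ha⟩ := hI.nonempty
  exact ⟨s, by rw [hsw.1 s a ha]; exact hI.subset ha⟩

theorem MaxGainStep.value_lt {π π' : S → A} (hs : M.MaxGainStep π π') (h : M.IsSuccessor next) :
    M.value π < M.value π' := by
  obtain ⟨s, hpos⟩ := hs.exists_gain_pos
  refine h.value_lt π π' (fun u => ?_) hpos
  rcases hs.switch u with hu | hu
  · rw [hu, h.gain_self]
  · exact hu.1.le

/-- The only place where the maximality of the gain matters: with equal successors, comparing gains
is comparing rewards. -/
theorem MaxGainStep.eq_or_isParallelMax {π π' : S → A} (hs : M.MaxGainStep π π')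
    (h : M.IsSuccessor next) (s : S) : π' s = π s ∨ M.IsParallelMax next s (π' s) := by
  refine (hs.switch s).imp_right fun hu a ha => ?_
  have := hu.2 a
  rw [h.gain_eq, h.gain_eq, ha] at this
  linarith

/-! ### Counting the policies of a run. -/

open Classical in
/-- If the policies `π t`, `t ∈ T`, have increasing values, coincide on `U`, and outside of `U` only
choose actions of maximal reward among the parallel ones, then their number is bounded by that of
the possible orbits. -/
theorem IsSuccessor.card_le_of_strictMonoOn [Fintype A] [Nonempty S] (h : M.IsSuccessor next)
    (π : ℕ → S → A) (π₀ : S → A) (T : Finset ℕ) (U : Set S)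
    (hU : ∀ t ∈ T, ∀ s ∈ U, π t s = π₀ s)
    (hmax : ∀ t ∈ T, ∀ s ∉ U, M.IsParallelMax next s (π t s))
    (hmono : StrictMonoOn (fun t => M.value (π t)) T) :
    (T.card : ℝ) ≤ (Fintype.card S : ℝ) ^ 2 * Fintype.card A *
      ((Fintype.card A + 1).factorial : ℝ) ^
        (((Fintype.card S : ℝ) - 1) / ((Fintype.card A : ℝ) + 1)) := by
  set X := ((Fintype.card A + 1).factorial : ℝ) ^
        (((Fintype.card S : ℝ) - 1) / ((Fintype.card A : ℝ) + 1)) with hX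
  -- The reward as a function of the move alone; the default 0 is never met by a policy in `T`.
  set ρ : S → S → ℝ := fun s s' => if s ∈ U then M.R s (π₀ s) else
    if hex : ∃ a, next s a = s' ∧ M.IsParallelMax next s a then M.R s hex.choose else 0 with hρ
  have hR : ∀ t ∈ T, ∀ s, M.R s (π t s) = ρ s (next s (π t s)) := fun t ht s => by
    by_cases hs : s ∈ U
    · simp only [hρ, if_pos hs, hU t ht s hs]
    · have hex : ∃ a, next s a = next s (π t s) ∧ M.IsParallelMax next s a :=
        ⟨π t s, rfl, hmax t ht s hs⟩
      simp only [hρ, if_neg hs, dif_pos hex]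
      exact le_antisymm (hex.choose_spec.2 _ hex.choose_spec.1.symm)
        (hmax t ht s hs _ hex.choose_spec.1)
  set W : (S → S) → S → ℝ := fun g s => ∑' j : ℕ, M.γ ^ j * ρ (g^[j] s) (g^[j + 1] s) with hW
  -- The state u itself is added because σ fixes the states off the cycle; this is why k + 1 appears
  -- in place of k.
  set N : S → Finset S := fun u => insert u (Finset.univ.image (next u)) with hN
  have hNcard : ∀ u, (N u).card ≤ Fintype.card A + 1 := fun u =>
    (Finset.card_insert_le _ _).trans (Nat.succ_le_succ Finset.card_image_le)
  set P : S → S → Finset (Equiv.Perm S) := fun s v =>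
    Finset.univ.filter fun σ => σ v = s ∧ ∀ u, u ≠ v → σ u ∈ N u with hP
  have hPcard : ∀ s v, ((P s v).card : ℝ) ≤ X := fun s v => by
    have := card_restricted_perm_le N _ hNcard v s
    push_cast at this
    exact this
  have himage : ∀ s, (T.image fun t => M.value (π t) s) ⊆
      Finset.univ.biUnion fun v : S => ((Finset.univ : Finset A) ×ˢ P s v).image
        fun p => W (Function.update p.2 v (next v p.1)) s := fun s x hx => by
    obtain ⟨t, ht, rfl⟩ := Finset.mem_image.1 hx
    obtain ⟨v, σ, hv, hσ, horb⟩ := exists_perm_update_iterate_eq (fun u => next u (π t u)) s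
    refine Finset.mem_biUnion.2 ⟨v, Finset.mem_univ v, Finset.mem_image.2
      ⟨(π t v, σ), Finset.mem_product.2 ⟨Finset.mem_univ _, ?_⟩, ?_⟩⟩
    · refine Finset.mem_filter.2 ⟨Finset.mem_univ _, hv, fun u hu => ?_⟩
      rcases hσ u hu with h' | h'
      · rw [h']; exact Finset.mem_insert_self _ _
      · rw [h']
        exact Finset.mem_insert_of_mem (Finset.mem_image_of_mem _ (Finset.mem_univ _))
    · rw [h.value_eq]
      refine tsum_congr fun j => ?_
      rw [horb, horb, hR t ht, Function.iterate_succ_apply']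
  have hcard : ∀ s, ((T.image fun t => M.value (π t) s).card : ℝ) ≤
      Fintype.card S * (Fintype.card A * X) := fun s => by
    calc ((T.image fun t => M.value (π t) s).card : ℝ)
        ≤ ∑ v : S, (Fintype.card A : ℝ) * (P s v).card := by
          refine (Nat.cast_le.2 ((Finset.card_le_card (himage s)).trans
            Finset.card_biUnion_le)).trans ?_
          rw [Nat.cast_sum]
          refine Finset.sum_le_sum fun v _ => (Nat.cast_le.2 Finset.card_image_le).trans ?_
          rw [Finset.card_product, Finset.card_univ, Nat.cast_mul]
      _ ≤ ∑ v : S, (Fintype.card A : ℝ) * X := by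
          gcongr with v
          exact hPcard s v
      _ = _ := by rw [Finset.sum_const, Finset.card_univ, nsmul_eq_mul]
  calc (T.card : ℝ) ≤ ∑ s, ((T.image fun t => M.value (π t) s).card : ℝ) := by
        have := card_le_sum_card_image_of_strictMonoOn T (fun t => M.value (π t)) hmono
        exact_mod_cast this
    _ ≤ ∑ s : S, (Fintype.card S : ℝ) * (Fintype.card A * X) :=
        Finset.sum_le_sum fun s _ => hcard s
    _ = _ := by rw [Finset.sum_const, Finset.card_univ, nsmul_eq_mul]; ring

open Classical in
-- The times 0, …, L are grouped by |U t|, which has n + 1 possible values; as `U` is decreasing,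
-- equal cardinality means equal sets.
theorem IsSuccessor.succ_le_maxGainBound [Fintype A] [Nonempty S] (h : M.IsSuccessor next)
    (π : ℕ → S → A) (L : ℕ) (hstep : ∀ t < L, M.MaxGainStep (π t) (π (t + 1))) :
    (L : ℝ) + 1 ≤ maxGainBound (Fintype.card S) (Fintype.card A) := by
  set U : ℕ → Finset S := fun t =>
    Finset.univ.filter fun s => ¬ M.IsParallelMax next s (π t s) with hU
  have hmem : ∀ t s, s ∈ U t ↔ ¬ M.IsParallelMax next s (π t s) := by simp [hU]
  have hstay : ∀ t < L, ∀ s ∈ U (t + 1), π (t + 1) s = π t s := fun t ht s hs =>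
    ((hstep t ht).eq_or_isParallelMax h s).resolve_right ((hmem _ _).1 hs)
  have hsub : ∀ t < L, U (t + 1) ⊆ U t := fun t ht s hs => by
    rw [hmem, ← hstay t ht s hs]
    exact (hmem _ _).1 hs
  have hanti : ∀ t t', t ≤ t' → t' ≤ L → U t' ⊆ U t := fun t t' htt => by
    induction t', htt using Nat.le_induction with
    | base => exact fun _ => subset_rfl
    | succ t' _ ih => exact fun hL => (hsub t' hL).trans (ih (Nat.le_of_succ_le hL))
  have hinit : ∀ t ≤ L, ∀ s ∈ U t, π t s = π 0 s := fun t => by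
    induction t with
    | zero => exact fun _ _ _ => rfl
    | succ t ih => exact fun hL s hs =>
        (hstay t hL s hs).trans (ih (Nat.le_of_succ_le hL) s (hsub t hL hs))
  have hlt : ∀ t t', t < t' → t' ≤ L → M.value (π t) < M.value (π t') := fun t t' htt => by
    induction t', htt using Nat.le_induction with
    | base => exact fun hL => (hstep t hL).value_lt h
    | succ t' _ ih =>
      exact fun hL => (ih (Nat.le_of_succ_le hL)).trans ((hstep t' hL).value_lt h)
  set X := ((Fintype.card A + 1).factorial : ℝ) ^
        (((Fintype.card S : ℝ) - 1) / ((Fintype.card A : ℝ) + 1)) with hX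
  have hphase : ∀ c, (((Finset.range (L + 1)).filter fun t => (U t).card = c).card : ℝ) ≤
      (Fintype.card S : ℝ) ^ 2 * Fintype.card A * X := fun c => by
    set T := (Finset.range (L + 1)).filter fun t => (U t).card = c with hT
    rcases T.eq_empty_or_nonempty with h0 | ⟨t₀, ht₀⟩
    · rw [h0, Finset.card_empty, Nat.cast_zero]
      positivity
    have hTL : ∀ t ∈ T, t ≤ L ∧ (U t).card = c := fun t ht => by
      rw [hT, Finset.mem_filter, Finset.mem_range] at ht
      exact ⟨by omega, ht.2⟩
    have hconst : ∀ t ∈ T, U t = U t₀ := fun t ht => by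
      obtain ⟨hL, hc⟩ := hTL t ht
      obtain ⟨hL₀, hc₀⟩ := hTL t₀ ht₀
      rcases le_total t t₀ with hle | hle
      · exact (Finset.eq_of_subset_of_card_le (hanti _ _ hle hL₀) (by omega)).symm
      · exact Finset.eq_of_subset_of_card_le (hanti _ _ hle hL) (by omega)
    refine h.card_le_of_strictMonoOn π (π 0) T (U t₀) (fun t ht s hs => ?_) (fun t ht s hs => ?_)
      fun t _ t' ht' htt => hlt t t' htt (hTL t' ht').1
    · rw [Finset.mem_coe, ← hconst t ht] at hs
      exact hinit t (hTL t ht).1 s hs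
    · rw [Finset.mem_coe, ← hconst t ht, hmem, not_not] at hs
      exact hs
  have hfib := Finset.card_eq_sum_card_fiberwise (s := Finset.range (L + 1))
    (t := Finset.range (Fintype.card S + 1)) (f := fun t => (U t).card)
    fun t _ => by
      simpa [Nat.lt_succ_iff] using Finset.card_le_univ (U t)
  calc (L : ℝ) + 1 = ((Finset.range (L + 1)).card : ℝ) := by simp
    _ = ∑ c ∈ Finset.range (Fintype.card S + 1),
        (((Finset.range (L + 1)).filter fun t => (U t).card = c).card : ℝ) := by
        rw [hfib, Nat.cast_sum]
    _ ≤ ∑ c ∈ Finset.range (Fintype.card S + 1),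
        (Fintype.card S : ℝ) ^ 2 * Fintype.card A * X := Finset.sum_le_sum fun c _ => hphase c
    _ = maxGainBound (Fintype.card S) (Fintype.card A) := by
        rw [Finset.sum_const, Finset.card_range, nsmul_eq_mul, maxGainBound]
        push_cast
        ring

end MDP

theorem mainTheorem2 :
    (∀ (S A : Type*) [Fintype S] [Fintype A],
      2 ≤ Fintype.card S → 2 ≤ Fintype.card A →
      ∀ M : MDP S A, M.IsDeterministic →
      ∀ π : ℕ → S → A, M.IsMaxGainRun π →
        ∃ l : ℕ, (l : ℝ) + 1 ≤ maxGainBound (Fintype.card S) (Fintype.card A) ∧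
          (∀ t < l, M.MaxGainStep (π t) (π (t + 1))) ∧
          M.improvableSet (π l) = ∅ ∧ M.IsOptimal (π l)) ∧
    (∃ C c : ℝ, 0 < C ∧ 0 < c ∧ ∀ n k : ℕ, 2 ≤ n → 2 ≤ k →
      maxGainBound n k ≤
        C * (n : ℝ) ^ 3 *
          ((1 + c * (Real.log (k : ℝ) / (k : ℝ))) * ((k : ℝ) / Real.exp 1)) ^ n) := by
  refine ⟨?_, 2 * Real.exp 1, 10, by positivity, by norm_num, maxGainBound_le⟩
  intro S A _ _ hS _ M hM π hπ
  classical
  have : Nonempty S := Fintype.card_pos_iff.1 (by omega)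
  obtain ⟨next, hnext⟩ := hM.exists_isSuccessor
  -- A run that never stopped would contain arbitrarily many steps, against the bound.
  have hex : ∃ t, M.improvableSet (π t) = ∅ := by
    by_contra! hne
    obtain ⟨L, hL⟩ := exists_nat_gt (maxGainBound (Fintype.card S) (Fintype.card A))
    have := hnext.succ_le_maxGainBound π L fun t _ =>
      (hπ t).1 (hne t)
    linarith
  have hstep : ∀ t < Nat.find hex, M.MaxGainStep (π t) (π (t + 1)) := fun t ht =>
    (hπ t).1 (Set.nonempty_iff_ne_empty.2 (Nat.find_min hex ht))
  exact ⟨Nat.find hex, hnext.succ_le_maxGainBound π _ hstep, hstep, Nat.find_spec hex,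
    hnext.isOptimal _ (Nat.find_spec hex)⟩
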